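/- **Theorem (square grid graphs achieve asymptotic truth learning under the Bayesian model).** Fix $q$ with $\tfrac12<q<1$. For a finite graph $G=(V,E)$ let $\theta$ be uniform on $\{0,1\}$ and, given $\theta$, let the private signals $s_v\in\{0,1\}$ $(v\in V)$ be independent with $\mathbb P(s_v=\theta)=q$. Given a decision order $\sigma$ (a linear ordering of $V$), the agents take actions $a_v\in\{0,1\}$ in this order. When $v$ decides, it knows $G$, $q$, $\sigma$ and the decision rules of the earlier agents, and it observes its signal $s_v$ and the actions of the neighbors that come before it in $\sigma$; its action is a function of the observed values that maximizes the posterior probability of being equal to $\theta$ (ties may be resolved in any way, depending on $v$, $\sigma$, $G$ and the observed values). The learning quality of the network is $$L_\sigma(G)=\frac1{|V|}\sum_{v\in V}\mathbb P(a_v=\theta).$$ For $k\ge 1$ let $G_k$ be the $k\times k$ grid graph: its vertices are the lattice points $(i,j)$ with $1\le i,j\le k$, and $(i,j)$, $(i',j')$ are adjacent if and only if $|i-i'|+|j-j'|=1$. Then, however ties are resolved, the family $\{G_k : k\ge 1\}$, which contains arbitrarily large graphs, achieves asymptotic truth learning: $$\lim_{n\to\infty}\ \inf\Big\{\max_{\sigma}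 L_\sigma(G_k)\ :\ k\ge 1,\ k^2\ge n\Big\}=1 .$$ -/

import Mathlib

open Filter Topology

namespace SocialLearning

noncomputable section

/-- A decision order of the agents: `σ v` is the position at which `v` decides. -/
abbrev DecisionOrder (V : Type*) [Fintype V] : Type _ := V ≃ Fin (Fintype.card V)

/-- A family of actions: `a v s` is the action of agent `v` when the private signals of all the
agents are `s`.  (The two states, the signals and the actions are all valued in `Bool`.) -/
abbrev ActionProfile (V : Type*) : Type _ := V → (V → Bool) → Bool

section Model

variable {V : Type*} [Fintype V]

/-- The probability of the outcome "the ground truth is `θ` and the private signals are `s`": the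
ground truth is a fair coin, and given `θ` the signals are independent, each equal to `θ` with
probability `q`. -/
def weight (q : ℝ) (θ : Bool) (s : V → Bool) : ℝ :=
  (1 / 2) * ∏ v, if s v = θ then q else 1 - q

open Classical in
/-- The probability of an event, given as a predicate of the ground truth and the signals. -/
def prob (q : ℝ) (E : Bool → (V → Bool) → Prop) : ℝ :=
  ∑ θ : Bool, ∑ s : V → Bool, if E θ s then weight q θ s else 0

/-- The set `N_σ(v)` of the neighbors of `v` that decide before `v`. -/
def earlierNeighbors (G : SimpleGraph V) (σ : DecisionOrder V) (v : V) : Set V :=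
  {u | G.Adj v u ∧ σ u < σ v}

/-- Agent `v` has the same information under the signals `s` and `s'`: the same private signal and
the same actions of the neighbors that decided before. -/
def SameInfo (G : SimpleGraph V) (σ : DecisionOrder V) (a : ActionProfile V) (v : V)
    (s s' : V → Bool) : Prop :=
  s v = s' v ∧ ∀ u ∈ earlierNeighbors G σ v, a u s = a u s'

/-- The posterior probability that the ground truth is `b`, given the information that agent `v`
has when the signals are `s`. -/
def posterior (G : SimpleGraph V) (q : ℝ) (σ : DecisionOrder V) (a : ActionProfile V) (v : V)
    (s : V → Bool) (b : Bool) : ℝ :=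
  prob q (fun θ s' => θ = b ∧ SameInfo G σ a v s s') / prob q (fun _ s' => SameInfo G σ a v s s')

/-- `a` is a profile of actions in the learning network `(G, q, σ)` under the Bayesian model: the
action of each agent is determined by its information, and it has the largest posterior
probability of being the ground truth.  (If both values have the same posterior probability, then
the agent may take either.) -/
structure IsBayesian (G : SimpleGraph V) (q : ℝ) (σ : DecisionOrder V) (a : ActionProfile V) :
    Prop where
  determined : ∀ v s s', SameInfo G σ a v s s' → a v s = a v s'
  optimal : ∀ v s b, posterior G q σ a v s b ≤ posterior G q σ a v s (a v s)

/-- The learning quality `ℓ(v)` of agent `v`: the probability that its action is correct. -/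
def agentQuality (q : ℝ) (a : ActionProfile V) (v : V) : ℝ :=
  prob q (fun θ s => a v s = θ)

/-- The learning quality of the network: the average of the learning qualities of its agents. -/
def networkQuality (q : ℝ) (a : ActionProfile V) : ℝ :=
  (1 / (Fintype.card V : ℝ)) * ∑ v, agentQuality q a v

theorem sameInfo_congr {G : SimpleGraph V} {σ : DecisionOrder V} {a a' : ActionProfile V} {v : V}
    (h : ∀ u, σ u < σ v → a u = a' u) : SameInfo G σ a v = SameInfo G σ a' v := by
  funext s s'
  refine propext (and_congr_right fun _ => forall₂_congr fun u hu => ?_)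
  rw [h u hu.2]

theorem posterior_congr {G : SimpleGraph V} {q : ℝ} {σ : DecisionOrder V} {a a' : ActionProfile V}
    {v : V} (h : ∀ u, σ u < σ v → a u = a' u) : posterior G q σ a v = posterior G q σ a' v := by
  funext s b
  simp only [posterior, sameInfo_congr (G := G) h]

/-- In every learning network there are actions as the Bayesian model prescribes them. -/
theorem exists_isBayesian (G : SimpleGraph V) (q : ℝ) (σ : DecisionOrder V) :
    ∃ a : ActionProfile V, IsBayesian G q σ a := by
  classical
  have key : ∀ n : ℕ, ∃ a : ActionProfile V, ∀ v, (σ v : ℕ) < n →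
      (∀ s s', SameInfo G σ a v s s' → a v s = a v s') ∧
      ∀ s b, posterior G q σ a v s b ≤ posterior G q σ a v s (a v s) := by
    intro n
    induction n with
    | zero => exact ⟨fun _ _ => true, fun v hv => absurd hv (Nat.not_lt_zero _)⟩
    | succ n ih =>
      obtain ⟨a, ha⟩ := ih
      let c : ActionProfile V := fun v s =>
        decide (posterior G q σ a v s false ≤ posterior G q σ a v s true)
      let a' : ActionProfile V := fun v => if (σ v : ℕ) = n then c v else a v
      refine ⟨a', fun v hv => ?_⟩
      have hlt : ∀ u, σ u < σ v → a' u = a u := by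
        intro u hu
        have : (σ u : ℕ) < σ v := hu
        exact if_neg (by omega)
      rw [sameInfo_congr hlt, posterior_congr hlt]
      by_cases hvn : (σ v : ℕ) = n
      · have hv' : a' v = c v := if_pos hvn
        rw [hv']
        constructor
        · intro s s' h
          have hs : SameInfo G σ a v s = SameInfo G σ a v s' := by
            funext t
            refine propext (and_congr (by rw [h.1]) (forall₂_congr fun u hu => ?_))
            rw [h.2 u hu]
          have hp : posterior G q σ a v s = posterior G q σ a v s' := by
            funext b
            simp only [posterior, hs]
          simp only [c, hp]
        · intro s b
          by_cases hle : posterior G q σ a v s false ≤ posterior G q σ a v s true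
          · have : c v s = true := decide_eq_true hle
            rw [this]
            cases b
            · exact hle
            · exact le_rfl
          · have : c v s = false := decide_eq_false hle
            rw [this]
            cases b
            · exact le_rfl
            · exact (not_le.mp hle).le
      · have hv' : a' v = a v := if_neg hvn
        rw [hv']
        exact ha v (by omega)
  obtain ⟨a, ha⟩ := key (Fintype.card V)
  exact ⟨a, fun v => (ha v (σ v).isLt).1, fun v => (ha v (σ v).isLt).2⟩

end Model

/-- The family of graphs `G i` contains arbitrarily large graphs and achieves (network-wide)
asymptotic truth learning under the Bayesian model: however ties are resolved, the infimum, over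
the graphs of the family with at least `n` vertices, of the learning quality of the network under
an optimal decision order tends to `1` as `n` tends to infinity. -/
def AchievesTruthLearning (q : ℝ) {ι : Type*} {V : ι → Type*} [∀ i, Fintype (V i)]
    (G : ∀ i, SimpleGraph (V i)) : Prop :=
  (∀ N : ℕ, ∃ i, N ≤ Fintype.card (V i)) ∧
  ∀ a : ∀ i, DecisionOrder (V i) → ActionProfile (V i),
    (∀ i σ, IsBayesian (G i) q σ (a i σ)) →
    Tendsto
      (fun n : ℕ => ⨅ i : {i : ι // n ≤ Fintype.card (V i)},
        ⨆ σ : DecisionOrder (V i), networkQuality q (a i σ))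
      atTop (𝓝 1)

/-- The `k × k` grid graph: lattice points are adjacent if their `ℓ¹`-distance is `1`. -/
def gridGraph (k : ℕ) : SimpleGraph (Fin k × Fin k) where
  Adj x y := |((x.1 : ℕ) : ℤ) - ((y.1 : ℕ) : ℤ)| + |((x.2 : ℕ) : ℤ) - ((y.2 : ℕ) : ℤ)| = 1
  symm := ⟨fun x y h => by
    rw [abs_sub_comm ((y.1 : ℕ) : ℤ), abs_sub_comm ((y.2 : ℕ) : ℤ)]; exact h⟩
  loopless := ⟨fun x h => by simp at h⟩

end

end SocialLearning

/-! Let r = 1 - (2q-1)^2 < 1. A binary tree of height n is drawn in the lowest 2n rows, and the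
order makes each tree vertex see exactly its tree neighbors below and to the right. Actions then
depend only on signals in the subtree, so the two children of a branching vertex act independently
given θ.

A Bayesian agent does at least as well as any rule based on its information
(`IsBayesian.decisionQuality_le`). Compared with copying a neighbor, this shows that errors never
grow along observed edges. Compared with the majority of two independent children and its own
signal, it shows that a branching vertex multiplies the error bound by r
(`one_sub_decisionQuality_majority_le`). Hence the root errs with probability at most r^n
(`IsTreeOrder.vertical`, `IsTreeOrder.branching`).

From the root the order sweeps all rows from 2n upward, and copying carries the bound r^n to every
vertex there (`IsTreeOrder.error_le`). The lowest 2n rows are a fraction at most 2n/k of the grid.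
Choosing n first and then k large makes both losses small. -/

namespace SocialLearning

noncomputable section

/-! ### Signals given the ground truth: independence and the majority rule -/

section Probability

variable {V : Type*} [Fintype V]

/-- The probability of the private signals `s` given the ground truth `θ`. -/
def signalWeight (q : ℝ) (θ : Bool) (s : V → Bool) : ℝ :=
  ∏ v, if s v = θ then q else 1 - q

open Classical in
/-- The expectation, given the ground truth `θ`, of a function of the private signals. -/
def condExpect (q : ℝ) (θ : Bool) (f : (V → Bool) → ℝ) : ℝ :=
  ∑ s, signalWeight q θ s * f s

/-- The indicator function of the event that the decision `d` equals `θ`. -/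
def hit (d : (V → Bool) → Bool) (θ : Bool) (s : V → Bool) : ℝ :=
  if d s = θ then 1 else 0

/-- The probability that the decision `d` is correct. -/
def decisionQuality (q : ℝ) (d : (V → Bool) → Bool) : ℝ :=
  (condExpect q true (hit d true) + condExpect q false (hit d false)) / 2

theorem weight_eq (q : ℝ) (θ : Bool) (s : V → Bool) :
    weight q θ s = 1 / 2 * signalWeight q θ s := rfl

theorem agentQuality_eq (q : ℝ) (a : ActionProfile V) (v : V) :
    agentQuality q a v = decisionQuality q (a v) := by
  simp only [agentQuality, prob, decisionQuality, condExpect, hit, weight_eq, Fintype.sum_bool,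
    mul_ite, mul_one, mul_zero, add_div, Finset.sum_div]
  congr 1 <;> refine Finset.sum_congr rfl fun s _ => ?_ <;> split_ifs <;> ring

theorem signalWeight_pos {q : ℝ} (h₀ : 0 < q) (h₁ : q < 1) (θ : Bool) (s : V → Bool) :
    0 < signalWeight q θ s :=
  Finset.prod_pos fun v _ => by split_ifs <;> linarith

theorem weight_pos {q : ℝ} (h₀ : 0 < q) (h₁ : q < 1) (θ : Bool) (s : V → Bool) :
    0 < weight q θ s := by
  have := signalWeight_pos h₀ h₁ θ s
  rw [weight_eq]
  linarith

theorem condExpect_one (q : ℝ) (θ : Bool) : condExpect (V := V) q θ (fun _ => 1) = 1 := by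
  classical
  have h := Fintype.prod_sum (fun (_ : V) (b : Bool) => if b = θ then q else 1 - q)
  have hb : ∑ b : Bool, (if b = θ then q else 1 - q) = 1 := by cases θ <;> simp
  simp only [hb, Finset.prod_const_one] at h
  simp [condExpect, signalWeight, ← h]

theorem condExpect_add (q : ℝ) (θ : Bool) (f g : (V → Bool) → ℝ) :
    condExpect q θ (fun s => f s + g s) = condExpect q θ f + condExpect q θ g := by
  simp only [condExpect, mul_add, Finset.sum_add_distrib]

theorem condExpect_sub (q : ℝ) (θ : Bool) (f g : (V → Bool) → ℝ) :
    condExpect q θ (fun s => f s - g s) = condExpect q θ f - condExpect q θ g := by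
  simp only [condExpect, mul_sub, Finset.sum_sub_distrib]

theorem condExpect_mono {q : ℝ} (h₀ : 0 < q) (h₁ : q < 1) (θ : Bool) {f g : (V → Bool) → ℝ}
    (h : ∀ s, f s ≤ g s) : condExpect q θ f ≤ condExpect q θ g :=
  Finset.sum_le_sum fun s _ => mul_le_mul_of_nonneg_left (h s) (signalWeight_pos h₀ h₁ θ s).le

theorem condExpect_hit_nonneg {q : ℝ} (h₀ : 0 < q) (h₁ : q < 1) (θ : Bool)
    (d : (V → Bool) → Bool) : 0 ≤ condExpect q θ (hit d θ) :=
  Finset.sum_nonneg fun s _ => mul_nonneg (signalWeight_pos h₀ h₁ θ s).le (by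
    unfold hit; split_ifs <;> norm_num)

theorem condExpect_hit_le_one {q : ℝ} (h₀ : 0 < q) (h₁ : q < 1) (θ : Bool)
    (d : (V → Bool) → Bool) : condExpect q θ (hit d θ) ≤ 1 := by
  rw [← condExpect_one (V := V) q θ]
  exact condExpect_mono h₀ h₁ θ fun s => by unfold hit; split_ifs <;> norm_num

theorem decisionQuality_nonneg {q : ℝ} (h₀ : 0 < q) (h₁ : q < 1) (d : (V → Bool) → Bool) :
    0 ≤ decisionQuality q d := by
  have := condExpect_hit_nonneg h₀ h₁ true d
  have := condExpect_hit_nonneg h₀ h₁ false d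
  unfold decisionQuality
  linarith

theorem decisionQuality_le_one {q : ℝ} (h₀ : 0 < q) (h₁ : q < 1) (d : (V → Bool) → Bool) :
    decisionQuality q d ≤ 1 := by
  have := condExpect_hit_le_one h₀ h₁ true d
  have := condExpect_hit_le_one h₀ h₁ false d
  unfold decisionQuality
  linarith

/-- Functions of disjoint sets of signals are independent given the ground truth. -/
theorem condExpect_mul (q : ℝ) (θ : Bool) {f g : (V → Bool) → ℝ} {S T : Set V}
    (hf : DependsOn f S) (hg : DependsOn g T) (hST : Disjoint S T) :
    condExpect q θ (fun s => f s * g s) = condExpect q θ f * condExpect q θ g := by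
  classical
  -- Take two independent copies of the signals. Exchanging them off `S` preserves the product
  -- weight, and turns `f s * g s` on one copy into `f` on the first times `g` on the second.
  let mix : (V → Bool) × (V → Bool) → (V → Bool) × (V → Bool) := fun p =>
    (fun v => if v ∈ S then p.1 v else p.2 v, fun v => if v ∈ S then p.2 v else p.1 v)
  have hmix : Function.Involutive mix := by
    rintro ⟨s, t⟩
    ext v <;> by_cases hv : v ∈ S <;> simp [mix, hv]
  have hw : ∀ p, signalWeight q θ (mix p).1 * signalWeight q θ (mix p).2
      = signalWeight q θ p.1 * signalWeight q θ p.2 := by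
    rintro ⟨s, t⟩
    simp only [signalWeight, ← Finset.prod_mul_distrib]
    refine Finset.prod_congr rfl fun v _ => ?_
    by_cases hv : v ∈ S <;> simp [mix, hv, mul_comm]
  have h1 : condExpect q θ (fun s => f s * g s) =
      condExpect q θ (fun s => f s * g s) * condExpect (V := V) q θ (fun _ => 1) := by
    rw [condExpect_one, mul_one]
  rw [h1]
  simp only [condExpect, Finset.sum_mul_sum, ← Fintype.sum_prod_type']
  rw [← Equiv.sum_comp hmix.toPerm]
  refine Fintype.sum_congr _ _ fun p => ?_
  have h2 : f (mix p).1 = f p.1 := hf fun v hv => by simp [mix, hv]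
  have h3 : g (mix p).1 = g p.2 := hg fun v hv => by
    simp [mix, Set.disjoint_right.1 hST hv]
  change signalWeight q θ (mix p).1 * (f (mix p).1 * g (mix p).1) *
    (signalWeight q θ (mix p).2 * 1) = _
  rw [h2, h3]
  linear_combination (f p.1 * g p.2) * hw p

omit [Fintype V] in
theorem dependsOn_hit {d : (V → Bool) → Bool} {S : Set V} (h : DependsOn d S) (θ : Bool) :
    DependsOn (hit d θ) S := fun s t hst => by
  simp only [hit, h hst]

omit [Fintype V] in
theorem dependsOn_signal (v : V) : DependsOn (fun s : V → Bool => s v) {v} :=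
  fun _ _ h => h v rfl

/-- A private signal is correct with probability `q`. -/
theorem condExpect_hit_signal (q : ℝ) (θ : Bool) (v : V) :
    condExpect q θ (hit (fun s => s v) θ) = q := by
  classical
  -- The indicator that the signal of `v` is correct is written as a product over all agents with
  -- trivial factors off `v`, so that the expectation factorizes.
  have h := Fintype.prod_sum (fun (u : V) (b : Bool) =>
    (if b = θ then q else 1 - q) * (if u = v then (if b = θ then 1 else 0) else 1))
  have hb : ∀ u : V, ∑ b : Bool, (if b = θ then q else 1 - q) *
      (if u = v then (if b = θ then (1 : ℝ) else 0) else 1) = if u = v then q else 1 := by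
    intro u
    by_cases hu : u = v <;> cases θ <;> simp [hu]
  simp only [hb, Finset.prod_mul_distrib, Finset.prod_ite_eq', Finset.mem_univ, if_true] at h
  exact h.symm

theorem decisionQuality_signal (q : ℝ) (v : V) :
    decisionQuality q (fun s : V → Bool => s v) = q := by
  simp [decisionQuality, condExpect_hit_signal]

/-- The decision that follows `d` and `e` where they agree, and the signal of `v` otherwise. -/
def majority (d e : (V → Bool) → Bool) (v : V) (s : V → Bool) : Bool :=
  if d s = e s then d s else s v

theorem condExpect_hit_majority (q : ℝ) (θ : Bool) {d e : (V → Bool) → Bool} {v : V} {S T : Set V}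
    (hd : DependsOn d S) (he : DependsOn e T) (hST : Disjoint S T) (hvS : v ∉ S) (hvT : v ∉ T) :
    condExpect q θ (hit (majority d e v) θ) =
      q * (condExpect q θ (hit d θ) + condExpect q θ (hit e θ)) -
        (2 * q - 1) * (condExpect q θ (hit d θ) * condExpect q θ (hit e θ)) := by
  have hd' := dependsOn_hit hd θ
  have he' := dependsOn_hit he θ
  have hv' := dependsOn_hit (dependsOn_signal v) θ
  have hde : DependsOn (fun s => hit d θ s * hit e θ s) (S ∪ T) := fun s t hst => by
    simp only [hd' fun i hi => hst i (Or.inl hi), he' fun i hi => hst i (Or.inr hi)]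
  -- For indicators D, E, X the majority is DE + DX + EX - 2DEX. The last term is written as a sum
  -- so that additivity suffices.
  have hpt : hit (majority d e v) θ = fun s =>
      (hit d θ s * hit e θ s + (hit d θ s * hit (fun s => s v) θ s +
        hit e θ s * hit (fun s => s v) θ s)) -
      (hit d θ s * hit e θ s * hit (fun s => s v) θ s +
        hit d θ s * hit e θ s * hit (fun s => s v) θ s) := by
    funext s
    rcases Bool.eq_false_or_eq_true (d s) with h₁ | h₁ <;>
    rcases Bool.eq_false_or_eq_true (e s) with h₂ | h₂ <;>
    rcases Bool.eq_false_or_eq_true (s v) with h₃ | h₃ <;>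
    cases θ <;> simp [hit, majority, h₁, h₂, h₃]
  rw [hpt, condExpect_sub, condExpect_add, condExpect_add, condExpect_add,
    condExpect_mul q θ hde hv' (by simp [hvS, hvT]), condExpect_mul q θ hd' he' hST,
    condExpect_mul q θ hd' hv' (by simp [hvS]), condExpect_mul q θ he' hv' (by simp [hvT]),
    condExpect_hit_signal]
  ring

/-- Following two independent decisions of quality at least `1 - ε` where they agree, and a third
independent signal otherwise, multiplies the error bound `ε` by a constant less than `1`. -/
theorem one_sub_decisionQuality_majority_le {q : ℝ} (hq : 1 / 2 < q) (hq' : q < 1) {ε : ℝ}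
    {d e : (V → Bool) → Bool} {v : V} {S T : Set V}
    (hd : DependsOn d S) (he : DependsOn e T) (hST : Disjoint S T) (hvS : v ∉ S) (hvT : v ∉ T)
    (hqd : q ≤ decisionQuality q d) (hqe : q ≤ decisionQuality q e)
    (hεd : 1 - decisionQuality q d ≤ ε) (hεe : 1 - decisionQuality q e ≤ ε) :
    1 - decisionQuality q (majority d e v) ≤ (1 - (2 * q - 1) ^ 2) * ε := by
  have h₀ : 0 < q := by linarith
  have key : ∀ c₀ c₁ e₀ e₁ : ℝ, c₀ ≤ 1 → c₁ ≤ 1 → e₀ ≤ 1 → e₁ ≤ 1 →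
      q ≤ (c₀ + c₁) / 2 → q ≤ (e₀ + e₁) / 2 → 1 - (c₀ + c₁) / 2 ≤ ε → 1 - (e₀ + e₁) / 2 ≤ ε →
      1 - ((q * (c₀ + e₀) - (2 * q - 1) * (c₀ * e₀)) +
        (q * (c₁ + e₁) - (2 * q - 1) * (c₁ * e₁))) / 2 ≤ (1 - (2 * q - 1) ^ 2) * ε := by
    intro c₀ c₁ e₀ e₁ hc₀ hc₁ he₀ he₁ hc he hcε heε
    obtain ⟨m, hm⟩ : ∃ m, m = (c₀ + e₀) / 2 := ⟨_, rfl⟩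
    obtain ⟨n, hn⟩ : ∃ n, n = (c₁ + e₁) / 2 := ⟨_, rfl⟩
    -- For a fixed mean `m`, the majority is worst when both decisions have the same accuracy; its
    -- error is then (1 - m)(1 - (2q-1)m).
    have hA : c₀ * e₀ ≤ m ^ 2 := by rw [hm]; nlinarith [sq_nonneg (c₀ - e₀)]
    have hB : c₁ * e₁ ≤ n ^ 2 := by rw [hn]; nlinarith [sq_nonneg (c₁ - e₁)]
    -- Only the average over the two states is known to be at least q. Since m + n ≥ 2q and n ≤ 1,
    -- still m ≥ 2q - 1; this is where the constant comes from.
    have hC : (2 * q - 1) * (1 - m) ≤ m * (1 - m) :=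
      mul_le_mul_of_nonneg_right (by linarith) (by linarith)
    have hD : (2 * q - 1) * (1 - n) ≤ n * (1 - n) :=
      mul_le_mul_of_nonneg_right (by linarith) (by linarith)
    have hE : (2 * q - 1) * ((2 * q - 1) * (1 - (m + n) / 2)) ≤
        (2 * q - 1) * ((m + n) / 2 - (c₀ * e₀ + c₁ * e₁) / 2) :=
      mul_le_mul_of_nonneg_left (by nlinarith) (by linarith)
    have hF : (1 - (2 * q - 1) ^ 2) * (1 - (m + n) / 2) ≤ (1 - (2 * q - 1) ^ 2) * ε :=
      mul_le_mul_of_nonneg_left (by linarith) (by nlinarith)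
    refine le_trans ?_ hF
    have h1 : c₀ + e₀ = 2 * m := by linarith
    have h2 : c₁ + e₁ = 2 * n := by linarith
    rw [h1, h2]
    linarith
  have h := key _ _ _ _ (condExpect_hit_le_one h₀ hq' true d) (condExpect_hit_le_one h₀ hq' false d)
    (condExpect_hit_le_one h₀ hq' true e) (condExpect_hit_le_one h₀ hq' false e) hqd hqe hεd hεe
  rw [← condExpect_hit_majority q true hd he hST hvS hvT,
    ← condExpect_hit_majority q false hd he hST hvS hvT] at h
  exact h

end Probability

/-! ### Bayesian agents: optimality, copying and combining -/

section Bayesian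

variable {V : Type*} [Fintype V] {G : SimpleGraph V} {q : ℝ} {σ : DecisionOrder V}
  {a : ActionProfile V} {v : V}

theorem prob_sameInfo_pos (h₀ : 0 < q) (h₁ : q < 1) (s : V → Bool) :
    0 < prob q (fun _ s' => SameInfo G σ a v s s') := by
  classical
  refine Finset.sum_pos' (fun θ _ => Finset.sum_nonneg fun t _ => ?_)
    ⟨true, Finset.mem_univ _, Finset.sum_pos' (fun t _ => ?_) ⟨s, Finset.mem_univ _, ?_⟩⟩
  · have := weight_pos h₀ h₁ θ t
    split_ifs <;> linarith
  · have := weight_pos h₀ h₁ true t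
    split_ifs <;> linarith
  · rw [if_pos ⟨rfl, fun _ _ => rfl⟩]
    exact weight_pos h₀ h₁ true s

open Classical in
theorem prob_eq_and_sameInfo (s : V → Bool) (b : Bool) :
    prob q (fun θ s' => θ = b ∧ SameInfo G σ a v s s') =
      ∑ s' with SameInfo G σ a v s s', 1 / 2 * signalWeight q b s' := by
  rw [prob, Fintype.sum_bool, Finset.sum_filter]
  cases b <;> simp [weight_eq]

-- For given signals exactly one ground truth makes the decision correct. In this form the quality
-- can be summed over information classes.
open Classical in
theorem decisionQuality_eq_sum (d : (V → Bool) → Bool) :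
    decisionQuality q d = ∑ s, 1 / 2 * signalWeight q (d s) s := by
  simp only [decisionQuality, condExpect, ← Finset.sum_add_distrib, Finset.sum_div]
  refine Finset.sum_congr rfl fun s _ => ?_
  cases h : d s <;> simp [hit, h] <;> ring

/-- The action of an agent is at least as good as any decision on the basis of its information. -/
theorem IsBayesian.decisionQuality_le (ha : IsBayesian G q σ a) (h₀ : 0 < q) (h₁ : q < 1)
    {d : (V → Bool) → Bool} (hd : ∀ s s', SameInfo G σ a v s s' → d s = d s') :
    decisionQuality q d ≤ decisionQuality q (a v) := by
  classical
  -- On each class of equal information both decisions are constant, so posterior optimality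
  -- compares the contributions class by class.
  let R : Setoid (V → Bool) :=
    { r := SameInfo G σ a v
      iseqv := ⟨fun _ => ⟨rfl, fun _ _ => rfl⟩, fun h => ⟨h.1.symm, fun u hu => (h.2 u hu).symm⟩,
        fun h h' => ⟨h.1.trans h'.1, fun u hu => (h.2 u hu).trans (h'.2 u hu)⟩⟩ }
  rw [decisionQuality_eq_sum, decisionQuality_eq_sum,
    ← Finset.sum_fiberwise Finset.univ (Quotient.mk R),
    ← Finset.sum_fiberwise Finset.univ (Quotient.mk R) fun s => 1 / 2 * signalWeight q (a v s) s]
  refine Finset.sum_le_sum fun c _ => ?_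
  induction c using Quotient.inductionOn with
  | h s =>
    have hfilter : (Finset.univ.filter fun t => Quotient.mk R t = Quotient.mk R s) =
        Finset.univ.filter fun t => SameInfo G σ a v s t := by
      ext t
      simp only [Finset.mem_filter, Finset.mem_univ, true_and, Quotient.eq]
      exact ⟨fun h => R.symm h, fun h => R.symm h⟩
    have hsum : ∀ e : (V → Bool) → Bool, (∀ s s', SameInfo G σ a v s s' → e s = e s') →
        ∑ t with SameInfo G σ a v s t, 1 / 2 * signalWeight q (e t) t =
          prob q (fun θ s' => θ = e s ∧ SameInfo G σ a v s s') := by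
      intro e he
      rw [prob_eq_and_sameInfo]
      refine Finset.sum_congr rfl fun t ht => ?_
      rw [he s t (Finset.mem_filter.1 ht).2]
    rw [hfilter, hsum d hd, hsum (a v) (ha.determined v)]
    have h := ha.optimal v s (d s)
    rwa [posterior, posterior, div_le_div_iff_of_pos_right (prob_sameInfo_pos h₀ h₁ s)] at h

theorem IsBayesian.le_decisionQuality (ha : IsBayesian G q σ a) (h₀ : 0 < q) (h₁ : q < 1) :
    q ≤ decisionQuality q (a v) := by
  have h := ha.decisionQuality_le (v := v) h₀ h₁ (d := fun s => s v) fun s s' h => h.1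
  rwa [decisionQuality_signal] at h

/-- An agent is at least as good as any neighbor that decides before. -/
theorem IsBayesian.decisionQuality_mono (ha : IsBayesian G q σ a) (h₀ : 0 < q) (h₁ : q < 1) {u : V}
    (hu : u ∈ earlierNeighbors G σ v) : decisionQuality q (a u) ≤ decisionQuality q (a v) :=
  ha.decisionQuality_le h₀ h₁ fun _ _ h => h.2 u hu

/-- Carries the supports of the actions up the tree; disjoint supports then give independence. -/
theorem IsBayesian.dependsOn (ha : IsBayesian G q σ a) {S : Set V} (hv : v ∈ S)
    (h : ∀ u ∈ earlierNeighbors G σ v, DependsOn (a u) S) : DependsOn (a v) S :=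
  fun s s' hs => ha.determined v s s' ⟨hs v hv, fun u hu => h u hu hs⟩

/-- An agent that sees the actions of two independent agents with errors at most `ε`. -/
theorem IsBayesian.error_le_of_disjoint (ha : IsBayesian G q σ a) (hq : 1 / 2 < q) (hq' : q < 1)
    {u w : V} {S T : Set V} {ε : ℝ} (hu : u ∈ earlierNeighbors G σ v)
    (hw : w ∈ earlierNeighbors G σ v) (hS : DependsOn (a u) S) (hT : DependsOn (a w) T)
    (hST : Disjoint S T) (hvS : v ∉ S) (hvT : v ∉ T)
    (hεu : 1 - decisionQuality q (a u) ≤ ε) (hεw : 1 - decisionQuality q (a w) ≤ ε) :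
    1 - decisionQuality q (a v) ≤ (1 - (2 * q - 1) ^ 2) * ε := by
  have h₀ : 0 < q := by linarith
  have h := ha.decisionQuality_le (v := v) h₀ hq' (d := majority (a u) (a w) v) fun s s' h => by
    simp only [majority, h.1, h.2 u hu, h.2 w hw]
  have h' := one_sub_decisionQuality_majority_le hq hq' hS hT hST hvS hvT
    (ha.le_decisionQuality h₀ hq') (ha.le_decisionQuality h₀ hq') hεu hεw
  linarith

end Bayesian

/-! ### The tree in the grid and its decision order -/

section Order

theorem exists_decisionOrder {V α : Type*} [Fintype V] [LinearOrder α] {key : V → α}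
    (hkey : Function.Injective key) :
    ∃ σ : DecisionOrder V, ∀ u v, σ u < σ v ↔ key u < key v := by
  let _ : LinearOrder V := LinearOrder.lift' key hkey
  exact ⟨(Fintype.orderIsoFinOfCardEq V rfl).symm.toEquiv, fun u v =>
    (Fintype.orderIsoFinOfCardEq V rfl).symm.lt_iff_lt⟩

theorem gridGraph_adj_iff {k : ℕ} {u v : Fin k × Fin k} : (gridGraph k).Adj u v ↔
    ((u.1 : ℕ) = v.1 ∧ ((u.2 : ℕ) + 1 = v.2 ∨ (v.2 : ℕ) + 1 = u.2)) ∨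
      ((u.2 : ℕ) = v.2 ∧ ((u.1 : ℕ) + 1 = v.1 ∨ (v.1 : ℕ) + 1 = u.1)) := by
  change |((u.1 : ℕ) : ℤ) - ((v.1 : ℕ) : ℤ)| + |((u.2 : ℕ) : ℤ) - ((v.2 : ℕ) : ℤ)| = 1 ↔ _
  rcases abs_cases (((u.1 : ℕ) : ℤ) - ((v.1 : ℕ) : ℤ)) with h | h <;>
  rcases abs_cases (((u.2 : ℕ) : ℤ) - ((v.2 : ℕ) : ℤ)) with h' | h' <;>
  rw [h.1, h'.1] <;> omega

/-- The lattice points of a binary tree that is drawn in the upper half plane with vertical and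
horizontal edges.  The vertices with two children are the points `(x, 2 * j + 1)` where
`2 ^ (j + 2)` divides `x`; the children are below and to the right. -/
def InTree (x y : ℕ) : Prop :=
  if y % 2 = 0 then 2 ^ (y / 2 + 1) ∣ x else x % 2 ^ (y / 2 + 2) ≤ 2 ^ (y / 2 + 1)

theorem inTree_even {x j : ℕ} : InTree x (2 * j) ↔ 2 ^ (j + 1) ∣ x := by
  simp [InTree]

theorem inTree_odd {x j : ℕ} :
    InTree x (2 * j + 1) ↔ x % (2 * 2 ^ (j + 1)) ≤ 2 ^ (j + 1) := by
  have h₁ : (2 * j + 1) % 2 ≠ 0 := by omega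
  have h₂ : (2 * j + 1) / 2 = j := by omega
  rw [InTree, if_neg h₁, h₂, pow_succ' 2 (j + 1)]

open Classical in
/-- The key by which the agents are ordered: first the vertices of the tree in the lowest `2 * n`
rows, from the leaves to the root, then all the vertices of the other rows, and finally the rest. -/
def treeKey (n x y : ℕ) : ℕ ×ₗ ℕ ×ₗ ℤ :=
  if y < 2 * n then
    -- The sign makes tree rows run from right to left, toward the branching vertices. Low vertices
    -- off the tree come last, so no tree vertex sees them.
    if InTree x y then toLex (0, toLex (y, -(x : ℤ))) else toLex (2, toLex (y, (x : ℤ)))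
  else toLex (1, toLex (y, (x : ℤ)))

theorem treeKey_injective {n x y x' y' : ℕ} (h : treeKey n x y = treeKey n x' y') :
    x = x' ∧ y = y' := by
  unfold treeKey at h
  split_ifs at h <;> simp at h <;> omega

/-- `σ` is a decision order by which the vertices of the tree in the lowest `2 * n` rows see just
their children, and which then proceeds from the root through all the other rows. -/
structure IsTreeOrder {k : ℕ} (n : ℕ) (σ : DecisionOrder (Fin k × Fin k)) : Prop where
  mem_iff : ∀ u v : Fin k × Fin k, InTree v.1 v.2 → (v.2 : ℕ) < 2 * n →
    (u ∈ earlierNeighbors (gridGraph k) σ v ↔ InTree u.1 u.2 ∧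
      ((u.1 : ℕ) = v.1 ∧ (u.2 : ℕ) + 1 = v.2 ∨ (u.1 : ℕ) = v.1 + 1 ∧ (u.2 : ℕ) = v.2))
  mem_of_le : ∀ u v : Fin k × Fin k, 2 * n ≤ (v.2 : ℕ) → (2 * n ≤ (u.2 : ℕ) ∨ InTree u.1 u.2) →
    ((u.1 : ℕ) = v.1 ∧ (u.2 : ℕ) + 1 = v.2 ∨ (u.1 : ℕ) + 1 = v.1 ∧ (u.2 : ℕ) = v.2) →
      u ∈ earlierNeighbors (gridGraph k) σ v

theorem exists_isTreeOrder (k n : ℕ) :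
    ∃ σ : DecisionOrder (Fin k × Fin k), IsTreeOrder n σ := by
  obtain ⟨σ, hσ⟩ := exists_decisionOrder
    (key := fun v : Fin k × Fin k => treeKey n v.1 v.2) fun u v h => by
      have := treeKey_injective h
      exact Prod.ext (Fin.ext this.1) (Fin.ext this.2)
  refine ⟨σ, fun u v hv hvn => ?_, fun u v hv hu huv => ?_⟩
  · rw [earlierNeighbors, Set.mem_ofPred_eq, gridGraph_adj_iff, hσ, treeKey, treeKey, if_pos hvn,
      if_pos hv]
    by_cases h : (u.2 : ℕ) < 2 * n
    · by_cases h' : InTree u.1 u.2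
      · simp only [h, h', if_true, Prod.Lex.toLex_lt_toLex, true_and]
        omega
      · simp only [h, h', if_true, if_false, Prod.Lex.toLex_lt_toLex, false_and, iff_false]
        omega
    · simp only [h, if_false, Prod.Lex.toLex_lt_toLex]
      omega
  · rw [earlierNeighbors, Set.mem_ofPred_eq, gridGraph_adj_iff, hσ, treeKey, treeKey,
      if_neg (not_lt.2 hv)]
    refine ⟨by omega, ?_⟩
    by_cases h : (u.2 : ℕ) < 2 * n
    · have h' : InTree u.1 u.2 := hu.resolve_left (not_le.2 h)
      simp only [h, h', if_true, Prod.Lex.toLex_lt_toLex]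
      omega
    · simp only [h, if_false, Prod.Lex.toLex_lt_toLex, true_and]
      omega

end Order

/-! ### Error bounds along the tree and above it -/

section Grid

variable {k n : ℕ} {q : ℝ} {σ : DecisionOrder (Fin k × Fin k)} {a : ActionProfile (Fin k × Fin k)}

/-- The horizontal edges of the tree in row `2 * j + 1`, given the subtrees of height `j`. -/
theorem IsTreeOrder.horizontal (hσ : IsTreeOrder n σ) (ha : IsBayesian (gridGraph k) q σ a)
    (h₀ : 0 < q) (h₁ : q < 1) {ε : ℝ} {j M : ℕ} (hM : M = 2 ^ (j + 1)) (hj : 2 * j + 1 < 2 * n)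
    (ih : ∀ v : Fin k × Fin k, (v.2 : ℕ) = 2 * j → M ∣ v.1 → v.1 + M ≤ k →
      DependsOn (a v) {w | v.1 ≤ w.1 ∧ (w.1 : ℕ) < v.1 + M ∧ (w.2 : ℕ) ≤ 2 * j} ∧
        1 - decisionQuality q (a v) ≤ ε)
    {x : ℕ} (hx : 2 * M ∣ x) (hxk : x + 2 * M ≤ k) (i : ℕ) (hi : i < M) (v : Fin k × Fin k)
    (hv₁ : (v.1 : ℕ) + i = x + M) (hv₂ : (v.2 : ℕ) = 2 * j + 1) :
    DependsOn (a v) {w | v.1 ≤ w.1 ∧ (w.1 : ℕ) < x + 2 * M ∧ (w.2 : ℕ) ≤ 2 * j + 1 ∧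
      ((w.2 : ℕ) = 2 * j + 1 ∨ x + M ≤ w.1)} ∧ 1 - decisionQuality q (a v) ≤ ε := by
  obtain ⟨c, rfl⟩ := hx
  -- Needed so that M + 1 < 2M: the right neighbor of the end of a horizontal segment is then off
  -- the tree.
  have hM2 : 2 ≤ M := by
    rw [hM, pow_succ]
    have := Nat.one_le_two_pow (n := j)
    omega
  have hmod : ∀ t, t < 2 * M → (2 * M * c + t) % (2 * M) = t := fun t ht => by
    rw [Nat.mul_add_mod, Nat.mod_eq_of_lt ht]
  induction i generalizing v with
  | zero =>
    have hvM : (v.1 : ℕ) = 2 * M * c + M := by omega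
    have hvT : InTree v.1 v.2 := by
      rw [hv₂, inTree_odd, ← hM, hvM, hmod M (by omega)]
    have hmem := fun u => hσ.mem_iff u v hvT (by omega)
    let u : Fin k × Fin k := (v.1, ⟨2 * j, by omega⟩)
    have hu : u ∈ earlierNeighbors (gridGraph k) σ v := by
      refine (hmem u).2 ⟨?_, Or.inl ⟨rfl, hv₂.symm⟩⟩
      change InTree v.1 (2 * j)
      rw [inTree_even, ← hM, hvM]
      exact ⟨2 * c + 1, by ring⟩
    have hihu := ih u rfl ⟨2 * c + 1, by change (v.1 : ℕ) = _; rw [hvM]; ring⟩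
      (by change (v.1 : ℕ) + M ≤ k; omega)
    refine ⟨ha.dependsOn (by simp only [Set.mem_ofPred_eq]; omega) fun w hw => ?_,
      (by linarith [ha.decisionQuality_mono h₀ h₁ hu, hihu.2])⟩
    have hw' := (hmem w).1 hw
    have hwu : w = u := by
      refine Prod.ext (Fin.ext ?_) (Fin.ext ?_)
      · change (w.1 : ℕ) = v.1
        rcases hw'.2 with h | h
        · exact h.1
        · exfalso
          have := hw'.1
          rw [h.1, h.2, hv₂, inTree_odd, ← hM, hvM, add_assoc, hmod _ (by omega)] at this
          omega
      · change (w.2 : ℕ) = 2 * j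
        rcases hw'.2 with h | h
        · omega
        · exfalso
          have := hw'.1
          rw [h.1, h.2, hv₂, inTree_odd, ← hM, hvM, add_assoc, hmod _ (by omega)] at this
          omega
    rw [hwu]
    refine hihu.1.mono ?_
    intro z hz
    have hz' : (v.1 : ℕ) ≤ z.1 ∧ (z.1 : ℕ) < v.1 + M ∧ (z.2 : ℕ) ≤ 2 * j := hz
    simp only [Set.mem_ofPred_eq]
    omega
  | succ i IH =>
    obtain ⟨t, ht⟩ : ∃ t, t + (i + 1) = M := ⟨M - (i + 1), by omega⟩
    have hvM : (v.1 : ℕ) = 2 * M * c + t := by omega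
    have hvT : InTree v.1 v.2 := by
      rw [hv₂, inTree_odd, ← hM, hvM, hmod t (by omega)]
      omega
    have hmem := fun u => hσ.mem_iff u v hvT (by omega)
    let u : Fin k × Fin k := (⟨v.1 + 1, by omega⟩, v.2)
    have hu : u ∈ earlierNeighbors (gridGraph k) σ v := by
      refine (hmem u).2 ⟨?_, Or.inr ⟨rfl, rfl⟩⟩
      change InTree (v.1 + 1) v.2
      rw [hv₂, inTree_odd, ← hM, hvM, add_assoc, hmod _ (by omega)]
      omega
    have hihu := IH (by omega) u hv₂ (by change (v.1 : ℕ) + 1 + i = 2 * M * c + M; omega)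
    refine ⟨ha.dependsOn (by simp only [Set.mem_ofPred_eq]; omega) fun w hw => ?_,
      (by linarith [ha.decisionQuality_mono h₀ h₁ hu, hihu.2])⟩
    have hw' := (hmem w).1 hw
    have hwu : (w.1 : ℕ) = v.1 + 1 ∧ (w.2 : ℕ) = v.2 := by
      -- The vertex below is off the tree, because `M` does not divide the offset `t` with 0 < t <
      -- M.
      refine hw'.2.resolve_left fun h => ?_
      have h3 := hw'.1
      rw [show (w.2 : ℕ) = 2 * j by omega, inTree_even, ← hM, h.1, hvM, mul_assoc, mul_left_comm,
        Nat.dvd_add_right (dvd_mul_right _ _)] at h3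
      have := Nat.le_of_dvd (by omega) h3
      omega
    rw [show w = u from Prod.ext (Fin.ext hwu.1) (Fin.ext hwu.2)]
    refine hihu.1.mono ?_
    intro z hz
    have hz' : (v.1 : ℕ) + 1 ≤ z.1 ∧ (z.1 : ℕ) < 2 * M * c + 2 * M ∧ (z.2 : ℕ) ≤ 2 * j + 1 ∧
      ((z.2 : ℕ) = 2 * j + 1 ∨ 2 * M * c + M ≤ z.1) := hz
    simp only [Set.mem_ofPred_eq]
    omega

/-- The vertices with two children in row `2 * j + 1`, given the subtrees of height `j`. -/
theorem IsTreeOrder.branching (hσ : IsTreeOrder n σ) (ha : IsBayesian (gridGraph k) q σ a)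
    (hq : 1 / 2 < q) (hq' : q < 1) {ε : ℝ} {j M : ℕ} (hM : M = 2 ^ (j + 1))
    (hj : 2 * j + 1 < 2 * n)
    (ih : ∀ v : Fin k × Fin k, (v.2 : ℕ) = 2 * j → M ∣ v.1 → v.1 + M ≤ k →
      DependsOn (a v) {w | v.1 ≤ w.1 ∧ (w.1 : ℕ) < v.1 + M ∧ (w.2 : ℕ) ≤ 2 * j} ∧
        1 - decisionQuality q (a v) ≤ ε)
    (v : Fin k × Fin k) (hv₁ : 2 * M ∣ v.1) (hv₂ : (v.2 : ℕ) = 2 * j + 1) (hvk : v.1 + 2 * M ≤ k) :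
    DependsOn (a v) {w | v.1 ≤ w.1 ∧ (w.1 : ℕ) < v.1 + 2 * M ∧ (w.2 : ℕ) ≤ 2 * j + 1} ∧
      1 - decisionQuality q (a v) ≤ (1 - (2 * q - 1) ^ 2) * ε := by
  have h₀ : 0 < q := by linarith
  have hM2 : 2 ≤ M := by
    rw [hM, pow_succ]
    have := Nat.one_le_two_pow (n := j)
    omega
  have hmod : ∀ t, t < 2 * M → (v.1 + t) % (2 * M) = t := fun t ht => by
    rw [Nat.add_mod, Nat.mod_eq_zero_of_dvd hv₁, zero_add, Nat.mod_mod, Nat.mod_eq_of_lt ht]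
  have hvT : InTree v.1 v.2 := by
    rw [hv₂, inTree_odd, ← hM, Nat.mod_eq_zero_of_dvd hv₁]
    exact Nat.zero_le _
  have hmem := fun u => hσ.mem_iff u v hvT (by omega)
  let u : Fin k × Fin k := (v.1, ⟨2 * j, by omega⟩)
  let u' : Fin k × Fin k := (⟨v.1 + 1, by omega⟩, v.2)
  have hdvd : M ∣ v.1 := (dvd_mul_left _ _).trans hv₁
  have hu : u ∈ earlierNeighbors (gridGraph k) σ v := by
    refine (hmem u).2 ⟨?_, Or.inl ⟨rfl, hv₂.symm⟩⟩
    change InTree v.1 (2 * j)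
    rwa [inTree_even, ← hM]
  have hu' : u' ∈ earlierNeighbors (gridGraph k) σ v := by
    refine (hmem u').2 ⟨?_, Or.inr ⟨rfl, rfl⟩⟩
    change InTree (v.1 + 1) v.2
    rw [hv₂, inTree_odd, ← hM, hmod _ (by omega)]
    omega
  obtain ⟨hS, hεu⟩ := ih u rfl hdvd (by change (v.1 : ℕ) + M ≤ k; omega)
  obtain ⟨hT, hεu'⟩ := hσ.horizontal ha h₀ hq' hM hj ih hv₁ hvk (M - 1) (by omega) u'
    (by change (v.1 : ℕ) + 1 + (M - 1) = _; omega) hv₂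
  have hSmem : ∀ z : Fin k × Fin k,
      z ∈ {w : Fin k × Fin k | u.1 ≤ w.1 ∧ (w.1 : ℕ) < u.1 + M ∧ (w.2 : ℕ) ≤ 2 * j} →
      (v.1 : ℕ) ≤ z.1 ∧ (z.1 : ℕ) < v.1 + M ∧ (z.2 : ℕ) ≤ 2 * j := fun z hz => hz
  have hTmem : ∀ z : Fin k × Fin k,
      z ∈ {w : Fin k × Fin k | u'.1 ≤ w.1 ∧ (w.1 : ℕ) < v.1 + 2 * M ∧ (w.2 : ℕ) ≤ 2 * j + 1 ∧
        ((w.2 : ℕ) = 2 * j + 1 ∨ v.1 + M ≤ (w.1 : ℕ))} →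
      (v.1 : ℕ) + 1 ≤ z.1 ∧ (z.1 : ℕ) < v.1 + 2 * M ∧ (z.2 : ℕ) ≤ 2 * j + 1 ∧
        ((z.2 : ℕ) = 2 * j + 1 ∨ v.1 + M ≤ (z.1 : ℕ)) := fun z hz => hz
  refine ⟨ha.dependsOn (by simp only [Set.mem_ofPred_eq]; omega) fun w hw => ?_,
    ha.error_le_of_disjoint hq hq' hu hu' hS hT (Set.disjoint_left.2 fun z hz hz' => ?_)
      (fun hz => ?_) (fun hz => ?_) hεu hεu'⟩
  · rcases ((hmem w).1 hw).2 with h | h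
    · rw [show w = u from Prod.ext (Fin.ext h.1) (Fin.ext (by change (w.2 : ℕ) = 2 * j; omega))]
      refine hS.mono fun z hz => ?_
      have := hSmem z hz
      simp only [Set.mem_ofPred_eq]
      omega
    · rw [show w = u' from Prod.ext (Fin.ext h.1) (Fin.ext h.2)]
      refine hT.mono fun z hz => ?_
      have := hTmem z hz
      simp only [Set.mem_ofPred_eq]
      omega
  -- The left subtree lies in rows up to 2j and columns before v + M; the other support lies in row
  -- 2j + 1 or in columns from v + M on.
  · have := hSmem z hz
    have := hTmem z hz'
    omega
  · have := hSmem v hz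
    omega
  · have := hTmem v hz
    omega

/-- The vertices of the tree in row `2 * j` have independent actions with small errors. -/
theorem IsTreeOrder.vertical (hσ : IsTreeOrder n σ) (ha : IsBayesian (gridGraph k) q σ a)
    (hq : 1 / 2 < q) (hq' : q < 1) (j : ℕ) (hj : j < n) (v : Fin k × Fin k)
    (hv₂ : (v.2 : ℕ) = 2 * j) (hv₁ : 2 ^ (j + 1) ∣ (v.1 : ℕ)) (hvk : v.1 + 2 ^ (j + 1) ≤ k) :
    DependsOn (a v) {w | v.1 ≤ w.1 ∧ (w.1 : ℕ) < v.1 + 2 ^ (j + 1) ∧ (w.2 : ℕ) ≤ 2 * j} ∧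
      1 - decisionQuality q (a v) ≤ (1 - (2 * q - 1) ^ 2) ^ j := by
  have h₀ : 0 < q := by linarith
  have hpos : ∀ j, 2 ≤ 2 ^ (j + 1) := fun j => by
    rw [pow_succ]
    have := Nat.one_le_two_pow (n := j)
    omega
  induction j generalizing v with
  | zero =>
    -- Leaves occupy even columns of row 0, so they see nobody; the error bound is the trivial 1.
    refine ⟨ha.dependsOn (by simp only [Set.mem_ofPred_eq]; omega) fun w hw => ?_, ?_⟩
    · exfalso
      have hw' := (hσ.mem_iff w v (by rwa [hv₂, inTree_even]) (by omega)).1 hw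
      rcases hw'.2 with h | h
      · omega
      · have h3 := hw'.1
        rw [h.2, hv₂, inTree_even, h.1] at h3
        omega
    · have := decisionQuality_nonneg h₀ hq' (a v)
      simpa using this
  | succ j IH =>
    have h2 : 2 ^ (j + 1 + 1) = 2 * 2 ^ (j + 1) := pow_succ' _ _
    have hmem := fun w => hσ.mem_iff w v (by rwa [hv₂, inTree_even]) (by omega)
    let u : Fin k × Fin k := (v.1, ⟨2 * j + 1, by omega⟩)
    obtain ⟨hS, hε⟩ := hσ.branching ha hq hq' rfl (by omega) (IH (by omega)) u
      (by rw [← h2]; exact hv₁) rfl (by rw [← h2]; exact hvk)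
    have hu : u ∈ earlierNeighbors (gridGraph k) σ v := by
      refine (hmem u).2 ⟨?_, Or.inl ⟨rfl, by change 2 * j + 1 + 1 = (v.2 : ℕ); omega⟩⟩
      change InTree v.1 (2 * j + 1)
      rw [inTree_odd, ← h2, Nat.mod_eq_zero_of_dvd hv₁]
      exact Nat.zero_le _
    have hpj := hpos (j + 1)
    refine ⟨ha.dependsOn (by simp only [Set.mem_ofPred_eq]; omega) fun w hw => ?_, ?_⟩
    · have hw' := (hmem w).1 hw
      have hwu := hw'.2.resolve_right fun h => by
        have h3 := hw'.1
        rw [h.2, hv₂, inTree_even, h.1, Nat.dvd_add_right hv₁] at h3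
        have := Nat.le_of_dvd one_pos h3
        omega
      rw [show w = u from Prod.ext (Fin.ext hwu.1)
        (Fin.ext (by change (w.2 : ℕ) = 2 * j + 1; omega))]
      refine hS.mono fun z hz => ?_
      have hz' : (v.1 : ℕ) ≤ z.1 ∧ (z.1 : ℕ) < v.1 + 2 * 2 ^ (j + 1) ∧ (z.2 : ℕ) ≤ 2 * j + 1 := hz
      rw [← h2] at hz'
      simp only [Set.mem_ofPred_eq]
      omega
    · have := ha.decisionQuality_mono h₀ hq' hu
      rw [pow_succ']
      linarith

/-- Above the tree, the error is exponentially small in the height of the tree. -/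
theorem IsTreeOrder.error_le (hσ : IsTreeOrder n σ) (ha : IsBayesian (gridGraph k) q σ a)
    (hq : 1 / 2 < q) (hq' : q < 1) (hk : 2 ^ (n + 1) ≤ k) (v : Fin k × Fin k)
    (hv : 2 * n ≤ (v.2 : ℕ)) : 1 - decisionQuality q (a v) ≤ (1 - (2 * q - 1) ^ 2) ^ n := by
  have h₀ : 0 < q := by linarith
  have hrow : ∀ x (v : Fin k × Fin k), (v.1 : ℕ) = x → (v.2 : ℕ) = 2 * n →
      1 - decisionQuality q (a v) ≤ (1 - (2 * q - 1) ^ 2) ^ n := by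
    intro x
    induction x with
    | zero =>
      intro v hv₁ hv₂
      cases n with
      | zero =>
        have := decisionQuality_nonneg h₀ hq' (a v)
        simpa using this
      | succ j =>
        have h2 : 2 ^ (j + 1 + 1) = 2 * 2 ^ (j + 1) := pow_succ' _ _
        let u : Fin k × Fin k := (v.1, ⟨2 * j + 1, by omega⟩)
        -- The root is (0, 2n - 1); its subtree spans 2^(n+1) columns, which is what `hk` provides.
        obtain ⟨-, hε⟩ := hσ.branching ha hq hq' rfl (by omega)
          (hσ.vertical ha hq hq' j (by omega)) u
          (by change _ ∣ (v.1 : ℕ); rw [hv₁]; exact dvd_zero _) rfl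
          (by change (v.1 : ℕ) + _ ≤ k; omega)
        have hu : u ∈ earlierNeighbors (gridGraph k) σ v := by
          refine hσ.mem_of_le u v hv₂.ge (Or.inr ?_)
            (Or.inl ⟨rfl, by change 2 * j + 1 + 1 = (v.2 : ℕ); omega⟩)
          change InTree v.1 (2 * j + 1)
          rw [inTree_odd, hv₁, Nat.zero_mod]
          exact Nat.zero_le _
        have := ha.decisionQuality_mono h₀ hq' hu
        rw [pow_succ']
        linarith
    | succ x IH =>
      intro v hv₁ hv₂
      let u : Fin k × Fin k := (⟨x, by omega⟩, v.2)
      have hu : u ∈ earlierNeighbors (gridGraph k) σ v :=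
        hσ.mem_of_le u v hv₂.ge (Or.inl hv₂.ge) (Or.inr ⟨hv₁.symm, rfl⟩)
      linarith [ha.decisionQuality_mono h₀ hq' hu, IH u rfl hv₂]
  obtain ⟨t, ht⟩ := Nat.exists_eq_add_of_le hv
  clear hv
  induction t generalizing v with
  | zero => exact hrow _ v rfl ht
  | succ t IH =>
    let u : Fin k × Fin k := (v.1, ⟨2 * n + t, by omega⟩)
    have hu : u ∈ earlierNeighbors (gridGraph k) σ v :=
      hσ.mem_of_le u v (by omega) (Or.inl (Nat.le_add_right _ _)) (Or.inl ⟨rfl, ht.symm⟩)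
    linarith [ha.decisionQuality_mono h₀ hq' hu, IH u rfl]

/-! ### Averaging over the network -/

theorem networkQuality_le_one {V : Type*} [Fintype V] {q : ℝ} (h₀ : 0 < q) (h₁ : q < 1)
    (a : ActionProfile V) : networkQuality q a ≤ 1 := by
  have h : ∑ v, agentQuality q a v ≤ Fintype.card V := by
    have := Finset.sum_le_card_nsmul Finset.univ (fun v => agentQuality q a v) 1 fun v _ => by
      rw [agentQuality_eq]
      exact decisionQuality_le_one h₀ h₁ _
    simpa using this
  rw [networkQuality, one_div_mul_eq_div]
  exact div_le_one_of_le₀ h (Nat.cast_nonneg _)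

theorem networkQuality_nonneg {V : Type*} [Fintype V] {q : ℝ} (h₀ : 0 < q) (h₁ : q < 1)
    (a : ActionProfile V) : 0 ≤ networkQuality q a :=
  mul_nonneg (by positivity) (Finset.sum_nonneg fun v _ => by
    rw [agentQuality_eq]
    exact decisionQuality_nonneg h₀ h₁ _)

theorem IsTreeOrder.le_networkQuality (hσ : IsTreeOrder n σ) (ha : IsBayesian (gridGraph k) q σ a)
    (hq : 1 / 2 < q) (hq' : q < 1) (hk : 2 ^ (n + 1) ≤ k) :
    1 - (1 - (2 * q - 1) ^ 2) ^ n - 2 * n / k ≤ networkQuality q a := by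
  have h₀ : 0 < q := by linarith
  have hr : 0 ≤ (1 - (2 * q - 1) ^ 2) ^ n := pow_nonneg (by nlinarith) n
  have hk0 : (0 : ℝ) < k := by
    have := Nat.one_le_two_pow (n := n + 1)
    exact_mod_cast (by omega : 0 < k)
  have hcard : ∑ y : Fin k, (if (y : ℕ) < 2 * n then (1 : ℝ) else 0) ≤ 2 * n := by
    rw [Finset.sum_boole]
    have h : (Finset.univ.filter fun y : Fin k => (y : ℕ) < 2 * n).card ≤
        (Finset.range (2 * n)).card :=
      Finset.card_le_card_of_injOn (fun y => (y : ℕ)) (fun y hy => by simpa using hy)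
        Fin.val_injective.injOn
    rw [Finset.card_range] at h
    exact_mod_cast h
  -- In the low rows quality is bounded below only by 0; subtracting 1 there makes one bound valid
  -- everywhere.
  have hsum : ∑ v : Fin k × Fin k, ((1 - (1 - (2 * q - 1) ^ 2) ^ n) -
      if (v.2 : ℕ) < 2 * n then (1 : ℝ) else 0) ≤ ∑ v, agentQuality q a v := by
    refine Finset.sum_le_sum fun v _ => ?_
    rw [agentQuality_eq]
    split_ifs with h
    · linarith [decisionQuality_nonneg h₀ hq' (a v)]
    · linarith [hσ.error_le ha hq hq' hk v (not_lt.1 h)]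
  have hprod : ∑ v : Fin k × Fin k, (if (v.2 : ℕ) < 2 * n then (1 : ℝ) else 0) =
      k * ∑ y : Fin k, (if (y : ℕ) < 2 * n then (1 : ℝ) else 0) :=
    (Fintype.sum_prod_type' fun (_ : Fin k) (y : Fin k) =>
      if (y : ℕ) < 2 * n then (1 : ℝ) else 0).trans (by
        rw [Finset.sum_const, Finset.card_univ, Fintype.card_fin, nsmul_eq_mul])
  rw [Finset.sum_sub_distrib, hprod] at hsum
  simp only [Finset.sum_const, Finset.card_univ, Fintype.card_prod, Fintype.card_fin,
    nsmul_eq_mul, Nat.cast_mul] at hsum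
  have h2 := mul_le_mul_of_nonneg_left hcard hk0.le
  rw [networkQuality, one_div_mul_eq_div, Fintype.card_prod, Fintype.card_fin, Nat.cast_mul,
    le_div_iff₀ (by positivity)]
  have h3 : (1 - (1 - (2 * q - 1) ^ 2) ^ n - 2 * n / k) * (k * k : ℝ) =
      k * k * (1 - (1 - (2 * q - 1) ^ 2) ^ n) - k * (2 * n) := by
    field_simp
  rw [h3]
  linarith

theorem exists_forall_le_networkQuality (hq : 1 / 2 < q) (hq' : q < 1) {ε : ℝ} (hε : 0 < ε) :
    ∃ K : ℕ, ∀ k, K ≤ k → ∃ σ : DecisionOrder (Fin k × Fin k), ∀ a,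
      IsBayesian (gridGraph k) q σ a → 1 - ε ≤ networkQuality q a := by
  obtain ⟨n, hn⟩ := exists_pow_lt_of_lt_one (half_pos hε)
    (show 1 - (2 * q - 1) ^ 2 < 1 by nlinarith)
  obtain ⟨m, hm⟩ := exists_nat_gt (2 * n / (ε / 2))
  -- `m` makes the low rows cost at most ε/2, and the power of two makes the tree fit.
  refine ⟨max m (2 ^ (n + 1)), fun k hk => ?_⟩
  obtain ⟨σ, hσ⟩ := exists_isTreeOrder k n
  refine ⟨σ, fun a ha => ?_⟩
  have h := hσ.le_networkQuality ha hq hq' ((le_max_right _ _).trans hk)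
  have hmk : (m : ℝ) ≤ k := by exact_mod_cast (le_max_left _ _).trans hk
  have hk0 : (0 : ℝ) < k := lt_of_lt_of_le (lt_of_le_of_lt (by positivity) hm) hmk
  have h2 : 2 * n / (k : ℝ) ≤ ε / 2 := by
    rw [div_le_iff₀ hk0, ← div_le_iff₀' (half_pos hε)]
    linarith
  linarith

end Grid

end

end SocialLearning

/-! ### The limit -/

theorem mainTheorem5 (q : ℝ) (hq : 1 / 2 < q) (hq' : q < 1) :
    SocialLearning.AchievesTruthLearning q
      (fun k : ℕ+ => SocialLearning.gridGraph (k : ℕ)) := by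
  have h₀ : 0 < q := by linarith
  have hlarge : ∀ N : ℕ, ∃ k : ℕ+, N ≤ Fintype.card (Fin (k : ℕ) × Fin (k : ℕ)) := fun N =>
    ⟨N.succPNat, by
      rw [Fintype.card_prod, Fintype.card_fin, Nat.succPNat_coe]
      nlinarith⟩
  refine ⟨hlarge, fun a ha => ?_⟩
  have hnonneg : ∀ k : ℕ+, 0 ≤ ⨆ σ, SocialLearning.networkQuality q (a k σ) := fun k =>
    Real.iSup_nonneg fun σ => SocialLearning.networkQuality_nonneg h₀ hq' _
  rw [tendsto_order]
  constructor
  · intro b hb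
    obtain ⟨K, hK⟩ := SocialLearning.exists_forall_le_networkQuality hq hq'
      (half_pos (sub_pos.2 hb))
    -- K² ≤ n ≤ k² forces k ≥ K.
    filter_upwards [eventually_ge_atTop (K * K)] with n hn
    -- A real infimum over an empty family would be 0, so large grids must exist.
    have : Nonempty {k : ℕ+ // n ≤ Fintype.card (Fin (k : ℕ) × Fin (k : ℕ))} :=
      (hlarge n).elim fun k hk => ⟨⟨k, hk⟩⟩
    refine lt_of_lt_of_le (show b < 1 - (1 - b) / 2 by linarith) (le_ciInf fun k => ?_)
    have hk := k.2
    rw [Fintype.card_prod, Fintype.card_fin] at hk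
    obtain ⟨σ, hσ⟩ := hK (k.1 : ℕ) (Nat.mul_self_le_mul_self_iff.1 (hn.trans hk))
    exact (hσ _ (ha k.1 σ)).trans (le_ciSup
      (f := fun σ => SocialLearning.networkQuality q (a k.1 σ)) (Set.finite_range _).bddAbove σ)
  · intro b hb
    refine Eventually.of_forall fun n => lt_of_le_of_lt ?_ hb
    obtain ⟨k, hk⟩ := hlarge n
    refine (ciInf_le ⟨0, ?_⟩ (⟨k, hk⟩ : {k : ℕ+ // n ≤ Fintype.card (Fin (k : ℕ) × Fin (k : ℕ))})).trans
      (Real.iSup_le (fun σ => SocialLearning.networkQuality_le_one h₀ hq' _) zero_le_one)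
    rintro _ ⟨i, rfl⟩
    exact hnonneg i.1
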